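/- Let $d,T\ge 1$ be integers, let $K\subseteq\mathbb R^d$ be compact, and let $\sigma:\mathbb R\to\mathbb R$ be continuous, bounded, injective, not a polynomial function, and such that $\sigma(0)=0$; $\sigma$ is applied to vectors entrywise. Let $\mu$ be a probability measure on $\mathbb R$ that is absolutely continuous with respect to Lebesgue measure and has full support. For $N\ge 1$, matrices $A_1,A_2^1,\dots,A_2^d\in\mathbb R^{N\times N}$ and vectors $\xi_1,\xi_2^1,\dots,\xi_2^d\in\mathbb R^N$, the randomised signature of $x=(x_1,\dots,x_T)\in(\mathbb R^d)^T$ is defined by $\mathrm{RS}_0(x)=0$ and $$\mathrm{RS}_t(x)=\mathrm{RS}_{t-1}(x)+\sigma\big(A_1\mathrm{RS}_{t-1}(x)+\xi_1\big)+\sum_{i=1}^d\sigma\big(A_2^i\,\mathrm{RS}_{t-1}(x)+\xi_2^i\big)\,x_t^i,\qquad t=1,\dots,T,$$ and $\Delta\mathrm{RS}_T(x):=\mathrm{RS}_T(x)-\mathrm{RS}_{T-1}(x)$. Sampling scheme with widths $M,M_1,\dots,M_d\ge 1$: let $N=M+M_1+\dots+M_d+Td$ and split $\mathbb R^N=\mathbb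 R^M\times\mathbb R^{M_1}\times\dots\times\mathbb R^{M_d}\times\mathbb R^{Td}$ into blocks numbered $0,1,\dots,d,d+1$. All blocks of $A_1,\xi_1,A_2^i,\xi_2^i$ vanish except the following. - $A_1$ has the block $A_1^{(1)}\in\mathbb R^{M\times Td}$ in position $(0,d+1)$ and the block $A_1^{(2)}=\begin{bmatrix}0_{d\times(T-1)d}&0_{d\times d}\\ U&0_{(T-1)d\times d}\end{bmatrix}\in\mathbb R^{Td\times Td}$ in position $(d+1,d+1)$, with $U\in\mathbb R^{(T-1)d\times(T-1)d}$ upper triangular. - $\xi_1$ has the block $\tilde\xi_1\in\mathbb R^M$ in position $0$. - $A_2^i$ has the block $\tilde A_2^i\in\mathbb R^{M_i\times Td}$ in position $(i,d+1)$. - $\xi_2^i$ has the block $\tilde\xi_2^i\in\mathbb R^{M_i}$ in position $i$ and the block $\alpha_i e_i$ in position $d+1$, with $\alpha_i\in\mathbb R$ and $e_i$ the $i$-th canonical basis vector of $\mathbb R^{Td}$. The entries of $A_1^{(1)},\tilde\xi_1,\tilde A_2^i,\tilde\xi_2^i$ ($i=1,\dots,d$), the entries of $U$ on and above its diagonal,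 and $\alpha_1,\dots,\alpha_d$ are jointly independent random variables on a probability space, each with distribution $\mu$. Proposition. Let $f:K^T\to\mathbb R$ be of the form $$f(x_1,\dots,x_T)=g(x_1,\dots,x_{T-1})+\sum_{i=1}^d h_i(x_1,\dots,x_{T-1})\,x_T^i$$ with continuous $g,h_1,\dots,h_d:K^{T-1}\to\mathbb R$. Then for every $\alpha\in(0,1)$ and $\varepsilon>0$ there are widths $M,M_1,\dots,M_d\ge1$ such that, under the sampling scheme with these widths, with probability greater than $\alpha$ there exist $\tilde w\in\mathbb R^M$ and $\tilde w_i\in\mathbb R^{M_i}$, $i=1,\dots,d$, for which the output vector $w=(\tilde w,\tilde w_1,\dots,\tilde w_d,0_{Td})\in\mathbb R^N$ satisfies $$\sup_{x_1,\dots,x_T\in K}\big|f(x_1,\dots,x_T)-\langle w,\Delta\mathrm{RS}_T(x_1,\dots,x_T)\rangle\big|<\varepsilon .$$ -/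

import Mathlib

open MeasureTheory ProbabilityTheory
open scoped Matrix

noncomputable section

namespace RandSig

/-- The randomised signature of a datastream `x : {1, …, T} → ℝ^d` (the value `x_{t+1}` is `x t`,
`t : Fin T`), as the sequence of its values at the times `0, 1, …, T`: it starts at `0` and satisfies
`RS_{t+1} = RS_t + σ(A₁ RS_t + ξ₁) + ∑ i, σ(A₂ⁱ RS_t + ξ₂ⁱ) x_{t+1}ⁱ`, where `σ` acts entrywise. -/
def randSig {ι : Type*} [Fintype ι] {T d : ℕ} (σ : ℝ → ℝ)
    (A₁ : Matrix ι ι ℝ) (ξ₁ : ι → ℝ) (A₂ : Fin d → Matrix ι ι ℝ) (ξ₂ : Fin d → ι → ℝ)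
    (x : Fin T → Fin d → ℝ) : Fin (T + 1) → ι → ℝ :=
  Fin.induction (motive := fun _ => ι → ℝ) 0 fun t RS j =>
    RS j + σ ((A₁ *ᵥ RS + ξ₁) j) + ∑ i, σ ((A₂ i *ᵥ RS + ξ₂ i) j) * x t i

/-- The terminal difference `RS_T(x) - RS_{T-1}(x)`, for the horizon `T = n + 1`. -/
def deltaRS {ι : Type*} [Fintype ι] {n d : ℕ} (σ : ℝ → ℝ)
    (A₁ : Matrix ι ι ℝ) (ξ₁ : ι → ℝ) (A₂ : Fin d → Matrix ι ι ℝ) (ξ₂ : Fin d → ι → ℝ)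
    (x : Fin (n + 1) → Fin d → ℝ) : ι → ℝ :=
  randSig σ A₁ ξ₁ A₂ ξ₂ x (Fin.last (n + 1)) - randSig σ A₁ ξ₁ A₂ ξ₂ x (Fin.last n).castSucc

/-- The assumption on the activation function. -/
structure IsAdmissibleActivation (σ : ℝ → ℝ) : Prop where
  continuous : Continuous σ
  bounded : ∃ C : ℝ, ∀ t, |σ t| ≤ C
  nonpolynomial : ¬ ∃ p : Polynomial ℝ, ∀ t, σ t = p.eval t
  injective : Function.Injective σ
  map_zero : σ 0 = 0

/-- The coordinates of the state space `ℝ^N`, `N = M + m₁ + ⋯ + m_d + T d`, in their blocks. In the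
last block, the coordinate `(k, i)` (both counted from `0`) is the coordinate number `k d + i` of
`ℝ^{T d}` (counted from `0`), so that the usual order of coordinates is the lexicographic one. -/
abbrev StateIdx (T d M : ℕ) (m : Fin d → ℕ) : Type :=
  Fin M ⊕ (Σ i : Fin d, Fin (m i)) ⊕ (Fin T × Fin d)

/-- Names of the random entries of the second sampling scheme, for the horizon `T = n + 1`: the
entries of `A₁⁽¹⁾`, `ξ̃₁`, `Ã₂ⁱ`, `ξ̃₂ⁱ`, the entries of the `(T-1)d × (T-1)d` matrix `U` on and above
the diagonal, and `α₁, …, α_d`. -/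
inductive HiddenIdx (n d M : ℕ) (m : Fin d → ℕ) : Type
  | A₁₁ (r : Fin M) (c : Fin (n + 1) × Fin d)
  | ξ₁ (r : Fin M)
  | A₂ (i : Fin d) (r : Fin (m i)) (c : Fin (n + 1) × Fin d)
  | ξ₂ (i : Fin d) (r : Fin (m i))
  | U (p q : Fin n × Fin d) (h : toLex p ≤ toLex q)
  | α (i : Fin d)

variable {n d M : ℕ} {m : Fin d → ℕ}

/-- The upper triangular matrix `U`. -/
def schemeU (z : HiddenIdx n d M m → ℝ) : Matrix (Fin n × Fin d) (Fin n × Fin d) ℝ :=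
  Matrix.of fun p q => if h : toLex p ≤ toLex q then z (.U p q h) else 0

/-- The matrix `A₁⁽²⁾ = [[0, 0], [U, 0]]`: its first `d` rows and its last `d` columns vanish. -/
def schemeA₁₂ (z : HiddenIdx n d M m → ℝ) :
    Matrix (Fin (n + 1) × Fin d) (Fin (n + 1) × Fin d) ℝ :=
  Matrix.of fun p q =>
    Fin.cases (motive := fun _ => ℝ) 0
      (fun k => Fin.lastCases (motive := fun _ => ℝ) 0
        (fun l => schemeU z (k, p.2) (l, q.2)) q.1) p.1

/-- The matrix `A₁`. -/
def schemeA₁ (z : HiddenIdx n d M m → ℝ) :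
    Matrix (StateIdx (n + 1) d M m) (StateIdx (n + 1) d M m) ℝ :=
  Matrix.of fun a b => match a, b with
    | .inl r, .inr (.inr c) => z (.A₁₁ r c)
    | .inr (.inr p), .inr (.inr q) => schemeA₁₂ z p q
    | _, _ => 0

/-- The vector `ξ₁`. -/
def schemeξ₁ (z : HiddenIdx n d M m → ℝ) : StateIdx (n + 1) d M m → ℝ
  | .inl r => z (.ξ₁ r)
  | .inr _ => 0

/-- The matrix `A₂ⁱ`. -/
def schemeA₂ (z : HiddenIdx n d M m → ℝ) (i : Fin d) :
    Matrix (StateIdx (n + 1) d M m) (StateIdx (n + 1) d M m) ℝ :=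
  Matrix.of fun a b => match a, b with
    | .inr (.inl s), .inr (.inr c) => if s.1 = i then z (.A₂ s.1 s.2 c) else 0
    | _, _ => 0

/-- The vector `ξ₂ⁱ`; its last block is `α_i e_i`. -/
def schemeξ₂ (z : HiddenIdx n d M m → ℝ) (i : Fin d) : StateIdx (n + 1) d M m → ℝ
  | .inl _ => 0
  | .inr (.inl s) => if s.1 = i then z (.ξ₂ s.1 s.2) else 0
  | .inr (.inr p) => if p = (0, i) then z (.α i) else 0

/-- The second sampling scheme: the random entries are i.i.d. with distribution `μ`. -/
structure IsSamplingScheme₂ {Ω : Type*} [MeasurableSpace Ω] (P : Measure Ω) (μ : Measure ℝ)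
    (ζ : HiddenIdx n d M m → Ω → ℝ) : Prop where
  measurable : ∀ e, Measurable (ζ e)
  indep : iIndepFun ζ P
  law : ∀ e, P.map (ζ e) = μ

/-- The terminal difference of the randomised signature of `x` whose hidden weights are built from
the entries `z` as the second sampling scheme prescribes. -/
def schemeDeltaRS (σ : ℝ → ℝ) (z : HiddenIdx n d M m → ℝ) (x : Fin (n + 1) → Fin d → ℝ) :
    StateIdx (n + 1) d M m → ℝ :=
  deltaRS σ (schemeA₁ z) (schemeξ₁ z) (schemeA₂ z) (schemeξ₂ z) x

/-- The output vector `w = (w̃, w̃₁, …, w̃_d, 0)`. -/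
def outputVec (T : ℕ) (w₀ : Fin M → ℝ) (w : (i : Fin d) → Fin (m i) → ℝ) :
    StateIdx T d M m → ℝ
  | .inl r => w₀ r
  | .inr (.inl s) => w s.1 s.2
  | .inr (.inr _) => 0

end RandSig

end

namespace RandSig

/-! ### Limits of the activation and steep neurons as step functions -/

open Filter Topology

/-! Since `σ 0 = 0` removes all other terms, the output is affine in the last datum. The
coefficients are networks with one hidden layer and i.i.d. weights, fed with the last block of the
state at time `T - 1` (`outputVec_dotProduct_schemeDeltaRS`). It remains to approximate `g` and each
`h i` by such networks.

The last block evolves autonomously and almost surely remembers `x_1, …, x_{T-1}`: as `μ` has no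
atoms, the diagonal of `U` and all `α_i` are nonzero, and then the recursion can be solved backwards
in time because `U` is triangular and `σ` injective (`lag_injective`).

Neurons on an injective image of a compact space span a dense subspace
(`topologicalClosure_span_neuron_eq_top`): a continuous injective `σ` is strictly monotone, so being
bounded it has two distinct limits at infinity. Averages of steep neurons then produce exponentials
of linear forms, and Stone–Weierstrass applies.

The embedding is itself random. Over a compact set of embeddings of nearly full mass, finitely many
fixed open boxes of weights suffice (`exists_boxes_of_isCompact`). Since `μ` has full support, a
wide random layer hits every box with high probability (`exists_width_random_features`). A union
bound over the `d + 1` networks concludes. -/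

lemma IsAdmissibleActivation.exists_limits {σ : ℝ → ℝ} (hσ : IsAdmissibleActivation σ) :
    ∃ l₀ l₁ : ℝ, l₀ ≠ l₁ ∧ Tendsto σ atBot (𝓝 l₀) ∧ Tendsto σ atTop (𝓝 l₁) := by
  have key : ∀ τ : ℝ → ℝ, StrictMono τ → (∃ C : ℝ, ∀ t, |τ t| ≤ C) →
      ∃ l₀ l₁ : ℝ, l₀ ≠ l₁ ∧ Tendsto τ atBot (𝓝 l₀) ∧ Tendsto τ atTop (𝓝 l₁) := by
    rintro τ hτ ⟨C, hC⟩
    have hA : BddAbove (Set.range τ) := ⟨C, by rintro _ ⟨t, rfl⟩; exact (abs_le.1 (hC t)).2⟩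
    have hB : BddBelow (Set.range τ) := ⟨-C, by rintro _ ⟨t, rfl⟩; exact (abs_le.1 (hC t)).1⟩
    refine ⟨⨅ t, τ t, ⨆ t, τ t, ne_of_lt ?_, tendsto_atBot_ciInf hτ.monotone hB,
      tendsto_atTop_ciSup hτ.monotone hA⟩
    calc ⨅ t, τ t ≤ τ 0 := ciInf_le hB 0
      _ < τ 1 := hτ one_pos
      _ ≤ ⨆ t, τ t := le_ciSup hA 1
  rcases hσ.continuous.strictMono_of_inj hσ.injective with h | h
  · exact key σ h hσ.bounded
  · obtain ⟨l₀, l₁, h1, h2, h3⟩ := key (fun t => -σ t) (fun a b hab => neg_lt_neg (h hab))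
      (by simpa using hσ.bounded)
    exact ⟨-l₀, -l₁, by simpa using h1, by simpa using h2.neg, by simpa using h3.neg⟩

/-- A closed subspace is complete, so the integral can be formed inside it. This keeps averages of
neurons in the closed span. -/
lemma intervalIntegral_mem_of_isClosed {E : Type*} [NormedAddCommGroup E] [NormedSpace ℝ E]
    [CompleteSpace E] {V : Submodule ℝ E} (hV : IsClosed (V : Set E)) {f : ℝ → E}
    (hf : Continuous f) (hmem : ∀ s, f s ∈ V) (a b : ℝ) : ∫ s in a..b, f s ∈ V := by
  have : CompleteSpace V := hV.completeSpace_coe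
  let f' : ℝ → V := fun s => ⟨f s, hmem s⟩
  have hf' : Continuous f' := hf.subtype_mk hmem
  have h := V.subtypeL.intervalIntegral_comp_comm (hf'.intervalIntegrable (μ := volume) a b)
  have h2 : ∫ s in a..b, f s = ((∫ s in a..b, f' s : V) : E) := by
    simpa [f'] using h
  rw [h2]
  exact (∫ s in a..b, f' s : V).2

/-- The limit of `v ↦ σ (k v)` as `k → ∞`, up to its value at `0`. -/
noncomputable def stepFun (l₀ l₁ v : ℝ) : ℝ := if 0 < v then l₁ else l₀

lemma measurable_stepFun (l₀ l₁ : ℝ) : Measurable (stepFun l₀ l₁) :=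
  Measurable.ite measurableSet_Ioi measurable_const measurable_const

lemma abs_stepFun_le (l₀ l₁ v : ℝ) : |stepFun l₀ l₁ v| ≤ |l₀| + |l₁| := by
  unfold stepFun
  split_ifs <;> linarith [abs_nonneg l₀, abs_nonneg l₁]

lemma tendsto_stepFun {σ : ℝ → ℝ} {l₀ l₁ : ℝ} (h₀ : Tendsto σ atBot (𝓝 l₀))
    (h₁ : Tendsto σ atTop (𝓝 l₁)) {v : ℝ} (hv : v ≠ 0) :
    Tendsto (fun k : ℕ => σ (k * v)) atTop (𝓝 (stepFun l₀ l₁ v)) := by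
  unfold stepFun
  rcases lt_or_gt_of_ne hv with h | h
  · rw [if_neg h.le.not_gt]
    exact h₀.comp (tendsto_natCast_atTop_atTop.atTop_mul_const_of_neg h)
  · rw [if_pos h]
    exact h₁.comp (tendsto_natCast_atTop_atTop.atTop_mul_const h)

lemma intervalIntegrable_of_measurable_of_bounded {f : ℝ → ℝ} (hf : Measurable f) {C : ℝ}
    (hC : ∀ t, |f t| ≤ C) (a b : ℝ) : IntervalIntegrable f volume a b := by
  refine (intervalIntegrable_const (c := C)).mono_fun hf.aestronglyMeasurable ?_
  exact ae_of_all _ fun t => by simpa using (hC t).trans (le_abs_self C)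

lemma tendsto_integral_sub_stepFun {σ : ℝ → ℝ} (hc : Continuous σ) {C : ℝ} (hC : ∀ t, |σ t| ≤ C)
    {l₀ l₁ : ℝ} (h₀ : Tendsto σ atBot (𝓝 l₀)) (h₁ : Tendsto σ atTop (𝓝 l₁)) (a b : ℝ) :
    Tendsto (fun k : ℕ => ∫ v in a..b, |σ (k * v) - stepFun l₀ l₁ v|) atTop (𝓝 0) := by
  have : (0 : ℝ) = ∫ v in a..b, (0 : ℝ) := by simp
  rw [this]
  refine intervalIntegral.tendsto_integral_filter_of_dominated_convergence
    (fun _ => C + (|l₀| + |l₁|)) ?_ ?_ intervalIntegrable_const ?_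
  · refine Eventually.of_forall fun k => Measurable.aestronglyMeasurable ?_
    exact continuous_abs.measurable.comp
      ((hc.measurable.comp (measurable_const.mul measurable_id)).sub (measurable_stepFun l₀ l₁))
  · refine Eventually.of_forall fun k => ae_of_all _ fun v _ => ?_
    rw [Real.norm_eq_abs, abs_abs]
    exact (abs_sub _ _).trans (add_le_add (hC _) (abs_stepFun_le _ _ _))
  · have : ∀ᵐ v : ℝ, v ≠ 0 := by simp [ae_iff]
    filter_upwards [this] with v hv _
    have := ((tendsto_stepFun h₀ h₁ hv).sub_const (stepFun l₀ l₁ v)).abs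
    simpa using this

/-- The step cuts the integral at `s = t`. As `exp` is its own antiderivative, the result is affine
in `exp t`, with a constant independent of `t`. -/
lemma integral_exp_mul_stepFun (l₀ l₁ : ℝ) {R t : ℝ} (h₁ : -R ≤ t) (h₂ : t ≤ R) :
    ∫ s in (-R)..R, Real.exp s * stepFun l₀ l₁ (t - s) =
      (l₁ - l₀) * Real.exp t + (l₀ * Real.exp R - l₁ * Real.exp (-R)) := by
  have hl : ∀ s ∈ Set.Ioo (-R) t, Real.exp s * stepFun l₀ l₁ (t - s) = Real.exp s * l₁ := by
    intro s hs; simp [stepFun, hs.2]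
  have hr : ∀ s ∈ Set.Ioo t R, Real.exp s * stepFun l₀ l₁ (t - s) = Real.exp s * l₀ := by
    intro s hs; simp [stepFun, hs.1.le]
  have hi : ∀ a b, IntervalIntegrable (fun s => Real.exp s * stepFun l₀ l₁ (t - s)) volume a b := by
    intro a b
    exact (intervalIntegrable_of_measurable_of_bounded
      ((measurable_stepFun l₀ l₁).comp (measurable_const.sub measurable_id))
      (fun s => abs_stepFun_le l₀ l₁ _) a b).continuousOn_mul Real.continuous_exp.continuousOn
  rw [← intervalIntegral.integral_add_adjacent_intervals (hi (-R) t) (hi t R)]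
  rw [intervalIntegral.integral_congr_Ioo_of_le h₁ hl,
    intervalIntegral.integral_congr_Ioo_of_le h₂ hr]
  simp
  ring

/-! ### Universal approximation through exponentials and Stone–Weierstrass -/

section UniversalApproximation

variable {X : Type*} [TopologicalSpace X] [CompactSpace X]

/-- Averaging the neurons `σ (k (u - s))` over `s` with weight `exp s` stays in `V`. As `k → ∞` the
average tends uniformly to `(l₁ - l₀) exp u` plus a constant, and constants lie in `V`. -/
lemma exp_comp_mem_of_sigmoidal {σ : ℝ → ℝ} (hc : Continuous σ) {C : ℝ}
    (hC : ∀ t, |σ t| ≤ C) {l₀ l₁ : ℝ} (hl : l₀ ≠ l₁) (h₀ : Tendsto σ atBot (𝓝 l₀))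
    (h₁ : Tendsto σ atTop (𝓝 l₁)) {V : Submodule ℝ C(X, ℝ)} (hV : IsClosed (V : Set C(X, ℝ)))
    (u : C(X, ℝ))
    (hmem : ∀ a b : ℝ, (⟨fun x => σ (a * u x + b), by fun_prop⟩ : C(X, ℝ)) ∈ V) :
    (⟨fun x => Real.exp (u x), by fun_prop⟩ : C(X, ℝ)) ∈ V := by
  classical
  have hconst : ∀ c : ℝ, ContinuousMap.const X c ∈ V := by
    intro c
    obtain ⟨b, hb⟩ : ∃ b, σ b ≠ 0 := by
      by_contra! hcon
      have hσ : σ = fun _ => 0 := funext hcon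
      rw [hσ] at h₀ h₁
      exact hl ((tendsto_nhds_unique h₀ tendsto_const_nhds).trans
        (tendsto_nhds_unique h₁ tendsto_const_nhds).symm)
    convert V.smul_mem (c / σ b) (hmem 0 b) using 1
    ext x
    simp [hb]
  set R : ℝ := ‖u‖ with hR
  have hu : ∀ x, -R ≤ u x ∧ u x ≤ R := fun x => abs_le.1 (u.norm_coe_le_norm x)
  have hR0 : 0 ≤ R := norm_nonneg u
  let Φ : ℕ → ℝ → C(X, ℝ) := fun k s => ⟨fun x => Real.exp s * σ (k * (u x - s)), by fun_prop⟩
  have hΦc : ∀ k, Continuous (Φ k) := fun k =>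
    ContinuousMap.continuous_of_continuous_uncurry _ (by
      simp only [Φ, Function.uncurry_def, ContinuousMap.coe_mk]; fun_prop)
  have hΦV : ∀ k s, Φ k s ∈ V := by
    intro k s
    convert V.smul_mem (Real.exp s) (hmem k (-(k * s))) using 1
    ext x
    simp [Φ, mul_sub, ← sub_eq_add_neg]
  let F : ℕ → C(X, ℝ) := fun k => ∫ s in (-R)..R, Φ k s
  have hFV : ∀ k, F k ∈ V := fun k => intervalIntegral_mem_of_isClosed hV (hΦc k) (hΦV k) _ _
  have hFx : ∀ k x, F k x = ∫ s in (-R)..R, Real.exp s * σ (k * (u x - s)) := by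
    intro k x
    exact ((ContinuousMap.evalCLM ℝ x).intervalIntegral_comp_comm
      ((hΦc k).intervalIntegrable (μ := volume) (-R) R)).symm
  let G : C(X, ℝ) := ⟨fun x => (l₁ - l₀) * Real.exp (u x) +
    (l₀ * Real.exp R - l₁ * Real.exp (-R)), by fun_prop⟩
  have hstep : ∀ a b, ∀ k : ℕ,
      IntervalIntegrable (fun v => |σ (k * v) - stepFun l₀ l₁ v|) volume a b := by
    intro a b k
    refine intervalIntegrable_of_measurable_of_bounded (C := C + (|l₀| + |l₁|))
      (continuous_abs.measurable.comp
      ((hc.measurable.comp (measurable_const.mul measurable_id)).sub (measurable_stepFun l₀ l₁)))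
      (fun v => ?_) a b
    exact (abs_abs _).trans_le
      ((abs_sub _ _).trans (add_le_add (hC _) (abs_stepFun_le _ _ _)))
  -- The substitution `v = u x - s` moves the dependence on `x` into the interval of integration.
  -- That interval lies in `[-2R, 2R]`, so `L¹` convergence of the steep neurons becomes uniform
  -- convergence in `x`.
  have hbound : ∀ k, ‖F k - G‖ ≤
      Real.exp R * ∫ v in (-(2 * R))..(2 * R), |σ (k * v) - stepFun l₀ l₁ v| := by
    intro k
    have hnn : 0 ≤ ∫ v in (-(2 * R))..(2 * R), |σ (k * v) - stepFun l₀ l₁ v| :=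
      intervalIntegral.integral_nonneg (by linarith) fun _ _ => abs_nonneg _
    refine (ContinuousMap.norm_le _ (mul_nonneg (Real.exp_pos R).le hnn)).2 fun x => ?_
    have hG : G x = ∫ s in (-R)..R, Real.exp s * stepFun l₀ l₁ (u x - s) :=
      (integral_exp_mul_stepFun l₀ l₁ (hu x).1 (hu x).2).symm
    have hi1 : IntervalIntegrable (fun s => Real.exp s * σ (k * (u x - s))) volume (-R) R :=
      Continuous.intervalIntegrable (by fun_prop) _ _
    have hi2 : IntervalIntegrable (fun s => Real.exp s * stepFun l₀ l₁ (u x - s)) volume (-R) R :=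
      (intervalIntegrable_of_measurable_of_bounded
        ((measurable_stepFun l₀ l₁).comp (measurable_const.sub measurable_id))
        (fun s => abs_stepFun_le l₀ l₁ _) _ _).continuousOn_mul Real.continuous_exp.continuousOn
    have hi3 : IntervalIntegrable
        (fun s => |σ (k * (u x - s)) - stepFun l₀ l₁ (u x - s)|) volume (-R) R := by
      simpa using (hstep (u x + R) (u x - R) k).comp_sub_left (u x)
    rw [ContinuousMap.sub_apply, hFx, hG, ← intervalIntegral.integral_sub hi1 hi2]
    calc ‖∫ s in (-R)..R, (Real.exp s * σ (k * (u x - s)) -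
            Real.exp s * stepFun l₀ l₁ (u x - s))‖
        ≤ ∫ s in (-R)..R, Real.exp R * |σ (k * (u x - s)) - stepFun l₀ l₁ (u x - s)| := by
          refine intervalIntegral.norm_integral_le_of_norm_le (by linarith) ?_
            (hi3.const_mul _)
          refine ae_of_all _ fun s hs => ?_
          rw [← mul_sub, norm_mul, Real.norm_eq_abs, Real.norm_eq_abs, Real.abs_exp]
          exact mul_le_mul_of_nonneg_right (Real.exp_le_exp.2 hs.2) (abs_nonneg _)
      _ = Real.exp R * ∫ v in (u x - R)..(u x + R), |σ (k * v) - stepFun l₀ l₁ v| := by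
          rw [intervalIntegral.integral_const_mul]
          congr 1
          rw [intervalIntegral.integral_comp_sub_left
            (fun v => |σ (k * v) - stepFun l₀ l₁ v|) (u x), sub_neg_eq_add]
      _ ≤ _ := by
          refine mul_le_mul_of_nonneg_left ?_ (Real.exp_pos R).le
          refine intervalIntegral.integral_mono_interval (by linarith [(hu x).1])
            (by linarith) (by linarith [(hu x).2]) ?_ (hstep _ _ k)
          exact ae_of_all _ fun _ => abs_nonneg _
  have hlim : Tendsto F atTop (𝓝 G) := by
    rw [tendsto_iff_norm_sub_tendsto_zero]
    refine squeeze_zero (fun _ => norm_nonneg _) hbound ?_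
    simpa using (tendsto_integral_sub_stepFun hc hC h₀ h₁ (-(2 * R)) (2 * R)).const_mul (Real.exp R)
  have hGV : G ∈ V := hV.mem_of_tendsto hlim (Eventually.of_forall hFV)
  have hne : l₁ - l₀ ≠ 0 := sub_ne_zero.2 hl.symm
  convert V.smul_mem (l₁ - l₀)⁻¹ (V.sub_mem hGV
    (hconst (l₀ * Real.exp R - l₁ * Real.exp (-R)))) using 1
  ext x
  simp [G, hne]

/-- The neuron `y ↦ σ(⟨a, y⟩ + b)` with weights `a = (v (some c))_c` and bias `b = v none`. -/
def neuron {ι : Type*} [Fintype ι] (σ : ℝ → ℝ) (v : Option ι → ℝ) (y : ι → ℝ) : ℝ :=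
  σ (∑ c, v (some c) * y c + v none)

lemma continuous_neuron {ι : Type*} [Fintype ι] {σ : ℝ → ℝ} (hc : Continuous σ) :
    Continuous fun p : (Option ι → ℝ) × (ι → ℝ) => neuron σ p.1 p.2 := by
  unfold neuron
  fun_prop

/-- Universal approximation: precomposed with a continuous injection of a compact space into `ℝ^ι`,
the neurons span a dense subspace of the continuous functions. -/
theorem topologicalClosure_span_neuron_eq_top {ι : Type*} [Fintype ι] {σ : ℝ → ℝ}
    (hσ : IsAdmissibleActivation σ) (φ : C(X, ι → ℝ)) (hφ : Function.Injective φ) :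
    (Submodule.span ℝ (Set.range fun v : Option ι → ℝ =>
      (⟨fun x => neuron σ v (φ x),
        (continuous_neuron hσ.continuous).comp (continuous_const.prodMk φ.continuous)⟩ :
          C(X, ℝ)))).topologicalClosure = ⊤ := by
  set V := (Submodule.span ℝ (Set.range fun v : Option ι → ℝ =>
      (⟨fun x => neuron σ v (φ x),
        (continuous_neuron hσ.continuous).comp (continuous_const.prodMk φ.continuous)⟩ :
          C(X, ℝ)))).topologicalClosure
  obtain ⟨C, hC⟩ := hσ.bounded
  obtain ⟨l₀, l₁, hl, h₀, h₁⟩ := hσ.exists_limits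
  let e : (ι → ℝ) → C(X, ℝ) := fun a => ⟨fun x => Real.exp (∑ c, a c * φ x c), by fun_prop⟩
  have heV : ∀ a, e a ∈ V := by
    intro a
    refine exp_comp_mem_of_sigmoidal hσ.continuous hC hl h₀ h₁
      (Submodule.isClosed_topologicalClosure _) ⟨fun x => ∑ c, a c * φ x c, by fun_prop⟩ ?_
    intro r b
    refine Submodule.le_topologicalClosure _ (Submodule.subset_span
      ⟨fun o => o.elim b fun c => r * a c, ?_⟩)
    ext x
    simp [neuron, Finset.mul_sum, mul_assoc]
  -- Exponentials of linear forms are closed under products, so the algebra they generate is just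
  -- their linear span.
  have hmul : ∀ f ∈ Submonoid.closure (Set.range e), f ∈ Set.range e := by
    intro f hf
    induction hf using Submonoid.closure_induction with
    | mem f hf => exact hf
    | one => exact ⟨0, by ext x; simp [e]⟩
    | mul f g _ _ hf hg =>
      obtain ⟨a, rfl⟩ := hf
      obtain ⟨b, rfl⟩ := hg
      exact ⟨a + b, by ext x; simp [e, add_mul, Finset.sum_add_distrib, Real.exp_add]⟩
  have hle : Subalgebra.toSubmodule (Algebra.adjoin ℝ (Set.range e)) ≤ V := by
    rw [Algebra.adjoin_eq_span, Submodule.span_le]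
    intro f hf
    obtain ⟨a, rfl⟩ := hmul f hf
    exact heV a
  have hsep : (Algebra.adjoin ℝ (Set.range e)).SeparatesPoints := by
    classical
    intro x y hxy
    obtain ⟨c, hcne⟩ := Function.ne_iff.1 (hφ.ne hxy)
    refine ⟨_, ⟨e (Pi.single c 1), Algebra.subset_adjoin ⟨_, rfl⟩, rfl⟩, ?_⟩
    simpa [e, Pi.single_apply] using hcne
  have htop := ContinuousMap.subalgebra_topologicalClosure_eq_top_of_separatesPoints _ hsep
  rw [eq_top_iff]
  intro f _
  have hf : f ∈ (Algebra.adjoin ℝ (Set.range e)).topologicalClosure := by rw [htop]; trivial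
  have hf' : f ∈ closure ((Algebra.adjoin ℝ (Set.range e) : Subalgebra ℝ C(X, ℝ)) : Set C(X, ℝ)) :=
    hf
  exact closure_minimal (fun g hg => hle hg) (Submodule.isClosed_topologicalClosure _) hf'

/-- Universal approximation by finitely many neurons. -/
theorem exists_sum_neuron_approx {ι : Type*} [Fintype ι] {σ : ℝ → ℝ}
    (hσ : IsAdmissibleActivation σ) (φ : C(X, ι → ℝ)) (hφ : Function.Injective φ)
    (G : C(X, ℝ)) {ε : ℝ} (hε : 0 < ε) :
    ∃ (k : ℕ) (c : Fin k → ℝ) (v : Fin k → Option ι → ℝ),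
      ∀ x, |G x - ∑ j, c j * neuron σ (v j) (φ x)| < ε := by
  have hG : G ∈ (Submodule.span ℝ (Set.range fun v : Option ι → ℝ =>
      (⟨fun x => neuron σ v (φ x),
        (continuous_neuron hσ.continuous).comp (continuous_const.prodMk φ.continuous)⟩ :
          C(X, ℝ)))).topologicalClosure := by
    rw [topologicalClosure_span_neuron_eq_top hσ φ hφ]; trivial
  obtain ⟨g, hg, hd⟩ := Metric.mem_closure_iff.1 hG ε hε
  obtain ⟨k, c, v, rfl⟩ := Submodule.mem_span_set'.1 hg
  choose w hw using fun j => (v j).2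
  refine ⟨k, c, w, fun x => ?_⟩
  have h1 := (ContinuousMap.dist_lt_iff hε).1 hd x
  rw [Real.dist_eq] at h1
  simpa [← hw, ContinuousMap.sum_apply] using h1

end UniversalApproximation

open scoped ENNReal

/-! ### Probability that an i.i.d. matrix has no row in a given box -/

section Hitting

variable {Ω : Type*} [MeasurableSpace Ω] {P : Measure Ω} [IsProbabilityMeasure P] {μ : Measure ℝ}
  {ρ κ : Type*} [Fintype ρ] [Fintype κ] {ζ : ρ × κ → Ω → ℝ}

/-- The probability that no row of an i.i.d. matrix belongs to a given box. -/
lemma measure_forall_row_notMem_box (hm : ∀ e, Measurable (ζ e)) (hi : iIndepFun ζ P)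
    (hlaw : ∀ e, P.map (ζ e) = μ) {S : κ → Set ℝ} (hS : ∀ c, MeasurableSet (S c)) :
    P (⋂ r, (⋂ c, ζ (r, c) ⁻¹' S c)ᶜ) = (1 - ∏ c, μ (S c)) ^ Fintype.card ρ := by
  classical
  set H : ρ → Set Ω := fun r => ⋂ c, ζ (r, c) ⁻¹' S c with hH
  have hHm : ∀ r, MeasurableSet (H r) := fun r => .iInter fun c => hm _ (hS c)
  have hinter : ∀ s : Finset ρ, P (⋂ r ∈ s, H r) = ∏ r ∈ s, ∏ c, μ (S c) := by
    intro s
    have h := hi.measure_inter_preimage_eq_mul (s ×ˢ Finset.univ) (sets := fun e => S e.2)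
      (fun e _ => hS e.2)
    have h1 : (⋂ e ∈ s ×ˢ (Finset.univ : Finset κ), ζ e ⁻¹' S e.2) = ⋂ r ∈ s, H r := by
      ext ω
      simp [hH]
      grind
    rw [h1, Finset.prod_product] at h
    rw [h]
    refine Finset.prod_congr rfl fun r _ => Finset.prod_congr rfl fun c _ => ?_
    rw [← hlaw (r, c), Measure.map_apply (hm _) (hS c)]
  have hone : ∀ r, P (H r) = ∏ c, μ (S c) := fun r => by simpa using hinter {r}
  have hind : iIndepSet H P := by
    rw [iIndepSet_iff_meas_biInter hHm]
    intro s
    rw [hinter s]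
    exact Finset.prod_congr rfl fun r _ => (hone r).symm
  have h := (iIndepSet_iff H P).1 hind Finset.univ (f := fun r => (H r)ᶜ)
    fun r _ => (MeasurableSpace.measurableSet_generateFrom (Set.mem_singleton _)).compl
  simp only [Finset.mem_univ, Set.iInter_true] at h
  rw [h]
  simp [prob_compl_eq_one_sub (hHm _), hone]

end Hitting

/-! ### Random neurons on a random embedding -/

section RandomFeatures

variable {X : Type*} [TopologicalSpace X] [CompactSpace X] {ι : Type*} [Fintype ι]
  {Θ : Type*} [TopologicalSpace Θ]

/-- Stability of universal approximation: uniformly over a compact set of embeddings, all choices of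
neurons in suitable boxes can approximate the target function. -/
theorem exists_boxes_of_isCompact {σ : ℝ → ℝ} (hσ : IsAdmissibleActivation σ)
    {Y : Θ → X → ι → ℝ} (hY : Continuous fun p : Θ × X => Y p.1 p.2) {C : Set Θ} (hC : IsCompact C)
    (hinj : ∀ θ ∈ C, Function.Injective (Y θ)) (G : C(X, ℝ)) {ε : ℝ} (hε : 0 < ε) :
    ∃ (J : Type) (_ : Fintype J) (S : J → Option ι → Set ℝ),
      (∀ j o, IsOpen (S j o) ∧ (S j o).Nonempty) ∧
      ∀ θ ∈ C, ∀ v : J → Option ι → ℝ, (∀ j o, v j o ∈ S j o) →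
        ∃ c : J → ℝ, ∀ x, |G x - ∑ j, c j * neuron σ (v j) (Y θ x)| < ε := by
  classical
  refine hC.induction_on (p := fun C => ∃ (J : Type) (_ : Fintype J) (S : J → Option ι → Set ℝ),
      (∀ j o, IsOpen (S j o) ∧ (S j o).Nonempty) ∧
      ∀ θ ∈ C, ∀ v : J → Option ι → ℝ, (∀ j o, v j o ∈ S j o) →
        ∃ c : J → ℝ, ∀ x, |G x - ∑ j, c j * neuron σ (v j) (Y θ x)| < ε) ?_ ?_ ?_ ?_
  · exact ⟨Empty, inferInstance, nofun, nofun, nofun⟩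
  · rintro s t hst ⟨J, hJ, S, hS, h⟩
    exact ⟨J, hJ, S, hS, fun θ hθ => h θ (hst hθ)⟩
  · rintro s t ⟨J₁, _, S₁, hS₁, h₁⟩ ⟨J₂, _, S₂, hS₂, h₂⟩
    refine ⟨J₁ ⊕ J₂, inferInstance, Sum.elim S₁ S₂, ?_, ?_⟩
    · rintro (j | j) o
      exacts [hS₁ j o, hS₂ j o]
    -- The two families of boxes are put side by side; the neurons of the family not needed for `θ`
    -- get coefficient zero.
    · rintro θ (hθ | hθ) v hv
      · obtain ⟨c, hc⟩ := h₁ θ hθ (fun j => v (.inl j)) fun j => hv (.inl j)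
        exact ⟨Sum.elim c 0, by simpa using hc⟩
      · obtain ⟨c, hc⟩ := h₂ θ hθ (fun j => v (.inr j)) fun j => hv (.inr j)
        exact ⟨Sum.elim 0 c, by simpa using hc⟩
  · intro θ hθ
    have hYθ : Continuous (Y θ) := hY.comp (continuous_const.prodMk continuous_id)
    obtain ⟨k, c, v, hv⟩ := exists_sum_neuron_approx hσ ⟨Y θ, hYθ⟩ (hinj θ hθ) G hε
    have hcont : Continuous fun q : (Θ × (Fin k → Option ι → ℝ)) × X =>
        |G q.2 - ∑ j, c j * neuron σ (q.1.2 j) (Y q.1.1 q.2)| := by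
      refine ((G.continuous.comp continuous_snd).sub
        (continuous_finsetSum _ fun j _ => continuous_const.mul ?_)).abs
      have h₁ : Continuous fun q : (Θ × (Fin k → Option ι → ℝ)) × X => q.1.2 j := by fun_prop
      have h₂ : Continuous fun q : (Θ × (Fin k → Option ι → ℝ)) × X => Y q.1.1 q.2 :=
        hY.comp ((continuous_fst.comp continuous_fst).prodMk continuous_snd)
      exact (continuous_neuron hσ.continuous).comp (h₁.prodMk h₂)
    -- By compactness of `X`, the same coefficients `c` keep the strict bound for all embeddings and
    -- weights near `(θ, v)`.
    have hev : ∀ᶠ q : Θ × (Fin k → Option ι → ℝ) in 𝓝 (θ, v), ∀ x ∈ Set.univ,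
        |G x - ∑ j, c j * neuron σ (q.2 j) (Y q.1 x)| < ε :=
      isCompact_univ.eventually_forall_of_forall_eventually fun x _ =>
        hcont.continuousAt.eventually_lt continuousAt_const (hv x)
    rw [nhds_prod_eq, eventually_prod_iff] at hev
    obtain ⟨p, hp, q, hq, hpq⟩ := hev
    obtain ⟨η, hη, hball⟩ := Metric.eventually_nhds_iff.1 hq
    refine ⟨{θ' | p θ'}, mem_nhdsWithin_of_mem_nhds hp, Fin k, inferInstance,
      fun j o => Metric.ball (v j o) η,
      fun j o => ⟨Metric.isOpen_ball, ⟨_, Metric.mem_ball_self hη⟩⟩, fun θ' hθ' v' hv' => ⟨c, ?_⟩⟩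
    have hdist : dist v' v < η :=
      (dist_pi_lt_iff hη).2 fun j => (dist_pi_lt_iff hη).2 fun o => hv' j o
    exact fun x => hpq hθ' (hball hdist) x trivial

/-- Random features: for a large width, neurons with i.i.d. weights, composed with a random embedding
of a compact space, approximate a given continuous function with high probability. -/
theorem exists_width_random_features {σ : ℝ → ℝ} (hσ : IsAdmissibleActivation σ)
    (μ : Measure ℝ) [IsProbabilityMeasure μ] [μ.IsOpenPosMeasure]
    [T2Space Θ] [MeasurableSpace Θ] [BorelSpace Θ] (ν : Measure Θ) [IsProbabilityMeasure ν]
    [ν.InnerRegularCompactLTTop] {Y : Θ → X → ι → ℝ}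
    (hY : Continuous fun p : Θ × X => Y p.1 p.2) {Θ₀ : Set Θ} (hΘ₀ : MeasurableSet Θ₀)
    (hν : ν Θ₀ = 1) (hinj : ∀ θ ∈ Θ₀, Function.Injective (Y θ)) (G : C(X, ℝ))
    {ε : ℝ} (hε : 0 < ε) {δ : ℝ≥0∞} (hδ : 0 < δ) :
    ∃ L : ℕ, 0 < L ∧ ∀ (Ω : Type*) [MeasurableSpace Ω] (P : Measure Ω) [IsProbabilityMeasure P]
      (θ : Ω → Θ) (ζ : Fin L × Option ι → Ω → ℝ), Measurable θ → P.map θ = ν →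
      (∀ e, Measurable (ζ e)) → iIndepFun ζ P → (∀ e, P.map (ζ e) = μ) →
      ∃ E : Set Ω, MeasurableSet E ∧ P Eᶜ ≤ δ ∧ ∀ ω ∈ E, ∃ w : Fin L → ℝ,
        ∀ x, |G x - ∑ r, w r * neuron σ (fun o => ζ (r, o) ω) (Y (θ ω) x)| < ε := by
  classical
  have hδ2 : δ / 2 ≠ 0 := (ENNReal.half_pos hδ.ne').ne'
  -- Half of `δ` pays for leaving the compact set `C`, half for missing some box. The boxes depend
  -- on `C` only, so a union bound suffices and `θ` and `ζ` need not be independent.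
  obtain ⟨C, hCΘ, hC, hCν⟩ : ∃ C ⊆ Θ₀, IsCompact C ∧ ν Θ₀ < ν C + δ / 2 :=
    hΘ₀.exists_isCompact_lt_add (by simp) hδ2
  obtain ⟨J, _, S, hS, happ⟩ :=
    exists_boxes_of_isCompact hσ hY hC (fun θ hθ => hinj θ (hCΘ hθ)) G hε
  have hSm : ∀ j o, MeasurableSet (S j o) := fun j o => (hS j o).1.measurableSet
  obtain ⟨L, hL, hL0⟩ : ∃ L : ℕ, ∑ j, (1 - ∏ o, μ (S j o)) ^ L < δ / 2 ∧ 0 < L := by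
    have hlim : Tendsto (fun L : ℕ => ∑ j, (1 - ∏ o, μ (S j o)) ^ L) atTop (𝓝 0) := by
      rw [← Finset.sum_const_zero (s := (Finset.univ : Finset J))]
      refine tendsto_finsetSum _ fun j _ => ENNReal.tendsto_pow_atTop_nhds_zero_of_lt_one ?_
      exact ENNReal.sub_lt_self (by simp) (by simp)
        (Finset.prod_ne_zero_iff.2 fun o _ => ((hS j o).1.measure_pos μ (hS j o).2).ne')
    exact ((hlim.eventually_lt_const (pos_iff_ne_zero.2 hδ2)).and (eventually_gt_atTop 0)).exists
  refine ⟨L, hL0, fun Ω _ P _ θ ζ hθ hθν hζ hind hlaw => ?_⟩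
  let H : J → Set Ω := fun j => ⋃ r, ⋂ o, ζ (r, o) ⁻¹' S j o
  have hHm : ∀ j, MeasurableSet (H j) := fun j =>
    .iUnion fun r => .iInter fun o => hζ _ (hSm j o)
  refine ⟨θ ⁻¹' C ∩ ⋂ j, H j, (hθ hC.measurableSet).inter (.iInter hHm), ?_, ?_⟩
  · have hθC : P (θ ⁻¹' C)ᶜ ≤ δ / 2 := by
      rw [← Set.preimage_compl, ← Measure.map_apply hθ hC.measurableSet.compl, hθν,
        prob_compl_eq_one_sub hC.measurableSet, tsub_le_iff_left, ← hν]
      exact hCν.le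
    have hH : ∀ j, P (H j)ᶜ = (1 - ∏ o, μ (S j o)) ^ L := by
      intro j
      have := measure_forall_row_notMem_box hζ hind hlaw (hSm j)
      rw [Fintype.card_fin] at this
      rw [← this, Set.compl_iUnion]
    calc P (θ ⁻¹' C ∩ ⋂ j, H j)ᶜ = P ((θ ⁻¹' C)ᶜ ∪ ⋃ j, (H j)ᶜ) := by
          rw [Set.compl_inter, Set.compl_iInter]
      _ ≤ P (θ ⁻¹' C)ᶜ + ∑ j, P (H j)ᶜ :=
          (measure_union_le _ _).trans (add_le_add_right (measure_iUnion_fintype_le _ _) _)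
      _ ≤ δ / 2 + δ / 2 := by
          refine add_le_add hθC ?_
          simp_rw [hH]
          exact hL.le
      _ = δ := ENNReal.add_halves δ
  · rintro ω ⟨hωC, hωH⟩
    have hhit : ∀ j, ∃ r, ∀ o, ζ (r, o) ω ∈ S j o := by
      intro j
      simpa [H] using Set.mem_iInter.1 hωH j
    choose r hr using hhit
    obtain ⟨c, hc⟩ := happ (θ ω) hωC (fun j o => ζ (r j, o) ω) hr
    -- One row may serve several boxes: its weight is the sum of their coefficients, and zero if it
    -- serves none.
    refine ⟨fun s => ∑ j with r j = s, c j, fun x => ?_⟩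
    convert hc x using 3
    simp_rw [Finset.sum_mul]
    rw [← Finset.sum_fiberwise Finset.univ r]
    refine Finset.sum_congr rfl fun s _ => Finset.sum_congr rfl fun j hj => ?_
    rw [(Finset.mem_filter.1 hj).2]

end RandomFeatures

/-! ### Dynamics of the last block and form of the output -/

section Dynamics

variable {n d M : ℕ} {m : Fin d → ℕ}

lemma randSig_succ {ι : Type*} [Fintype ι] {T d : ℕ} (σ : ℝ → ℝ)
    (A₁ : Matrix ι ι ℝ) (ξ₁ : ι → ℝ) (A₂ : Fin d → Matrix ι ι ℝ) (ξ₂ : Fin d → ι → ℝ)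
    (x : Fin T → Fin d → ℝ) (t : Fin T) (j : ι) :
    randSig σ A₁ ξ₁ A₂ ξ₂ x t.succ j = randSig σ A₁ ξ₁ A₂ ξ₂ x t.castSucc j +
      σ ((A₁ *ᵥ randSig σ A₁ ξ₁ A₂ ξ₂ x t.castSucc + ξ₁) j) +
      ∑ i, σ ((A₂ i *ᵥ randSig σ A₁ ξ₁ A₂ ξ₂ x t.castSucc + ξ₂ i) j) * x t i := rfl

/-- The evolution of the last block of the state, at the times `0, …, n`. -/
def lag (σ : ℝ → ℝ) (B : Matrix (Fin (n + 1) × Fin d) (Fin (n + 1) × Fin d) ℝ) (β : Fin d → ℝ)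
    (y : Fin n → Fin d → ℝ) : Fin (n + 1) → Fin (n + 1) × Fin d → ℝ :=
  Fin.induction (motive := fun _ => Fin (n + 1) × Fin d → ℝ) 0 fun t Y p =>
    Y p + σ ((B *ᵥ Y) p) + if p.1 = 0 then σ (β p.2) * y t p.2 else 0

lemma lag_zero (σ : ℝ → ℝ) (B : Matrix (Fin (n + 1) × Fin d) (Fin (n + 1) × Fin d) ℝ)
    (β : Fin d → ℝ) (y : Fin n → Fin d → ℝ) : lag σ B β y 0 = 0 := rfl

lemma lag_succ (σ : ℝ → ℝ) (B : Matrix (Fin (n + 1) × Fin d) (Fin (n + 1) × Fin d) ℝ)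
    (β : Fin d → ℝ) (y : Fin n → Fin d → ℝ) (t : Fin n) (p : Fin (n + 1) × Fin d) :
    lag σ B β y t.succ p = lag σ B β y t.castSucc p + σ ((B *ᵥ lag σ B β y t.castSucc) p) +
      if p.1 = 0 then σ (β p.2) * y t p.2 else 0 := rfl

lemma schemeA₁₂_last (z : HiddenIdx n d M m → ℝ) (p : Fin (n + 1) × Fin d) (j : Fin d) :
    schemeA₁₂ z p (Fin.last n, j) = 0 := by
  obtain ⟨k, i⟩ := p
  cases k using Fin.cases <;> simp [schemeA₁₂]

lemma schemeA₁₂_succ_castSucc (z : HiddenIdx n d M m → ℝ) (k l : Fin n) (i j : Fin d) :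
    schemeA₁₂ z (k.succ, i) (l.castSucc, j) = schemeU z (k, i) (l, j) := by
  simp [schemeA₁₂]

lemma schemeA₁₂_eq_zero_of_lt (z : HiddenIdx n d M m → ℝ) {k : Fin n} {i : Fin d}
    {q : Fin (n + 1) × Fin d} (h : toLex q < toLex (k.castSucc, i)) :
    schemeA₁₂ z (k.succ, i) q = 0 := by
  obtain ⟨l, j⟩ := q
  cases l using Fin.lastCases with
  | last => exact schemeA₁₂_last z _ j
  | cast l =>
    rw [schemeA₁₂_succ_castSucc, schemeU, Matrix.of_apply, dif_neg]
    rw [not_le]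
    rw [Prod.Lex.toLex_lt_toLex] at h ⊢
    simpa using h

variable {σ : ℝ → ℝ}

/-- Information descends at most one level per step: row `(k + 1, i)` reads only entries from `(k,
i)` onwards in lexicographic order. If these vanish, `σ 0 = 0` adds nothing. -/
lemma lag_eq_zero (h0 : σ 0 = 0) (z : HiddenIdx n d M m → ℝ) (β : Fin d → ℝ)
    (y : Fin n → Fin d → ℝ) (t : Fin (n + 1)) :
    ∀ p : Fin (n + 1) × Fin d, (t : ℕ) ≤ p.1 → lag σ (schemeA₁₂ z) β y t p = 0 := by
  induction t using Fin.induction with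
  | zero => intro p _; rw [lag_zero]; rfl
  | succ t ih =>
    rintro ⟨k, i⟩ hk
    cases k using Fin.cases with
    | zero => simp at hk
    | succ k =>
      simp only [Fin.val_succ, Nat.add_le_add_iff_right] at hk
      have hB : (schemeA₁₂ z *ᵥ lag σ (schemeA₁₂ z) β y t.castSucc) (k.succ, i) = 0 := by
        refine Finset.sum_eq_zero fun q _ => ?_
        by_cases hq : toLex q < toLex (k.castSucc, i)
        · exact mul_eq_zero_of_left (schemeA₁₂_eq_zero_of_lt z hq) _
        · refine mul_eq_zero_of_right _ (ih q ?_)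
          rw [Prod.Lex.toLex_lt_toLex] at hq
          simp only [not_or, not_lt, Fin.le_def, Fin.val_castSucc] at hq
          exact le_trans (by simpa using hk) hq.1
      rw [lag_succ, hB, h0, ih _ (by simp; omega)]
      simp

/-- One step of the last block can be undone. -/
lemma lag_step_injective (hσ : Function.Injective σ) (h0 : σ 0 = 0) (z : HiddenIdx n d M m → ℝ)
    (hU : ∀ p, z (.U p p le_rfl) ≠ 0) {β : Fin d → ℝ} {y y' : Fin n → Fin d → ℝ} {t : Fin n}
    (h : lag σ (schemeA₁₂ z) β y t.succ = lag σ (schemeA₁₂ z) β y' t.succ) :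
    lag σ (schemeA₁₂ z) β y t.castSucc = lag σ (schemeA₁₂ z) β y' t.castSucc := by
  set Y := lag σ (schemeA₁₂ z) β y t.castSucc with hY
  set Y' := lag σ (schemeA₁₂ z) β y' t.castSucc with hY'
  suffices H : ∀ p : Fin (n + 1) ×ₗ Fin d, Y (ofLex p) = Y' (ofLex p) from
    funext fun p => H (toLex p)
  intro p
  -- Descending lexicographic induction. The update of `(k + 1, i)` reveals row `(k, i)` of `U`
  -- applied to the state; all later entries are already known, and the nonzero diagonal entry
  -- yields the entry at `(k, i)`.
  induction p using (wellFounded_gt (α := Fin (n + 1) ×ₗ Fin d)).induction with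
  | h p ih =>
  obtain ⟨⟨k, i⟩, rfl⟩ := toLex.surjective p
  simp only [ofLex_toLex]
  by_cases hk : (t : ℕ) ≤ k
  · rw [hY, hY', lag_eq_zero h0 z β y _ (k, i) (by simpa using hk),
      lag_eq_zero h0 z β y' _ (k, i) (by simpa using hk)]
  obtain ⟨k, rfl⟩ : ∃ k' : Fin n, k = k'.castSucc := ⟨⟨k, by omega⟩, rfl⟩
  have hstep := congrFun h (k.succ, i)
  rw [lag_succ, lag_succ, ← hY, ← hY'] at hstep
  have hsucc : Y (k.succ, i) = Y' (k.succ, i) := by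
    refine ih (toLex (k.succ, i)) ?_
    exact Prod.Lex.toLex_lt_toLex.2 (Or.inl Fin.castSucc_lt_succ)
  rw [hsucc] at hstep
  have hB : (schemeA₁₂ z *ᵥ Y) (k.succ, i) = (schemeA₁₂ z *ᵥ Y') (k.succ, i) :=
    hσ (by simpa using hstep)
  have hD : ∑ q, schemeA₁₂ z (k.succ, i) q * (Y q - Y' q) = 0 := by
    simp only [mul_sub, Finset.sum_sub_distrib]
    exact sub_eq_zero.2 hB
  rw [Finset.sum_eq_single (k.castSucc, i)] at hD
  · rw [schemeA₁₂_succ_castSucc, schemeU, Matrix.of_apply, dif_pos le_rfl] at hD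
    exact sub_eq_zero.1 ((mul_eq_zero.1 hD).resolve_left (hU (k, i)))
  · intro q _ hq
    rcases lt_or_gt_of_ne (toLex.injective.ne hq) with hlt | hgt
    · exact mul_eq_zero_of_left (schemeA₁₂_eq_zero_of_lt z hlt) _
    · exact mul_eq_zero_of_right _ (sub_eq_zero.2 (ih (toLex q) hgt))
  · simp

/-- The last block at time `n` determines the datastream. -/
lemma lag_injective (hσ : Function.Injective σ) (h0 : σ 0 = 0) (z : HiddenIdx n d M m → ℝ)
    (hU : ∀ p, z (.U p p le_rfl) ≠ 0) {β : Fin d → ℝ} (hβ : ∀ i, β i ≠ 0) :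
    Function.Injective fun y => lag σ (schemeA₁₂ z) β y (Fin.last n) := by
  intro y y' h
  have hall : ∀ t, lag σ (schemeA₁₂ z) β y t = lag σ (schemeA₁₂ z) β y' t := by
    intro t
    induction t using Fin.reverseInduction with
    | last => exact h
    | cast t ih => exact lag_step_injective hσ h0 z hU ih
  -- With all states known, level `0` shows the increment `σ (β i) * y t i`, and `σ (β i) ≠ 0` by
  -- injectivity.
  funext t i
  have hstep := congrFun (hall t.succ) (0, i)
  rw [lag_succ, lag_succ, hall t.castSucc] at hstep
  have hne : σ (β i) ≠ 0 := fun hc => hβ i (hσ (hc.trans h0.symm))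
  simpa [hne] using hstep

/-- The entries of the scheme on which the last block of the state depends. -/
abbrev LagIdx (n d : ℕ) : Type := HiddenIdx n d 0 fun _ => 0

/-- The inclusion of the entries on which the last block of the state depends. -/
def LagIdx.incl : LagIdx n d → HiddenIdx n d M m
  | .A₁₁ r _ => r.elim0
  | .ξ₁ r => r.elim0
  | .A₂ _ r _ => r.elim0
  | .ξ₂ _ r => r.elim0
  | .U p q h => .U p q h
  | .α i => .α i

lemma LagIdx.incl_injective :
    Function.Injective (LagIdx.incl : LagIdx n d → HiddenIdx n d M m) := by
  rintro (⟨r, _⟩ | r | ⟨_, r, _⟩ | ⟨_, r⟩ | ⟨p, q, h⟩ | i)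
    (⟨s, _⟩ | s | ⟨_, s, _⟩ | ⟨_, s⟩ | ⟨p', q', h'⟩ | j) hij
  all_goals first
    | exact r.elim0
    | exact s.elim0
    | simp_all [LagIdx.incl]

/-- With zero widths only the entries of `U` and `α` remain; `Option` absorbs the pairs below the
diagonal. -/
instance : Finite (LagIdx n d) := by
  let f : ((Fin n × Fin d) × (Fin n × Fin d)) ⊕ Fin d → Option (LagIdx n d)
    | .inl (p, q) => if h : toLex p ≤ toLex q then some (.U p q h) else none
    | .inr i => some (.α i)
  have hf : ∀ e : LagIdx n d, ∃ a, f a = some e := by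
    rintro (⟨r, _⟩ | r | ⟨_, r, _⟩ | ⟨_, r⟩ | ⟨p, q, h⟩ | i)
    · exact r.elim0
    · exact r.elim0
    · exact r.elim0
    · exact r.elim0
    · exact ⟨.inl (p, q), by simp [f, h]⟩
    · exact ⟨.inr i, rfl⟩
  choose g hg using hf
  exact Finite.of_injective g fun a b hab =>
    Option.some_injective _ ((hg a).symm.trans ((congrArg f hab).trans (hg b)))

/-- The last block of the state at time `n`, as a function of the entries of the scheme and the
datastream. -/
def lagState (σ : ℝ → ℝ) (θ : LagIdx n d → ℝ) (y : Fin n → Fin d → ℝ) :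
    Fin (n + 1) × Fin d → ℝ :=
  lag σ (schemeA₁₂ θ) (fun i => θ (.α i)) y (Fin.last n)

lemma continuous_schemeA₁₂_apply (p q : Fin (n + 1) × Fin d) :
    Continuous fun z : HiddenIdx n d M m → ℝ => schemeA₁₂ z p q := by
  obtain ⟨k, i⟩ := p
  obtain ⟨l, j⟩ := q
  cases k using Fin.cases with
  | zero => exact continuous_const
  | succ k =>
    cases l using Fin.lastCases with
    | last => simp only [schemeA₁₂_last]; exact continuous_const
    | cast l =>
      simp only [schemeA₁₂_succ_castSucc, schemeU, Matrix.of_apply]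
      split_ifs
      · fun_prop
      · fun_prop

lemma continuous_lagState (hc : Continuous σ) :
    Continuous fun p : (LagIdx n d → ℝ) × (Fin n → Fin d → ℝ) => lagState σ p.1 p.2 := by
  unfold lagState
  generalize Fin.last n = t
  induction t using Fin.induction with
  | zero => exact continuous_const
  | succ t ih =>
    refine continuous_pi fun p => ?_
    simp only [lag_succ]
    have ih' : ∀ q, Continuous fun r : (LagIdx n d → ℝ) × (Fin n → Fin d → ℝ) =>
        lag σ (schemeA₁₂ r.1) (fun i => r.1 (.α i)) r.2 t.castSucc q :=
      fun q => (continuous_apply q).comp ih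
    refine ((ih' p).add (hc.comp ?_)).add ?_
    · exact continuous_finsetSum _ fun q _ =>
        ((continuous_schemeA₁₂_apply p q).comp continuous_fst).mul (ih' q)
    · split_ifs
      · fun_prop
      · exact continuous_const

lemma lagState_injective (hσ : IsAdmissibleActivation σ) {θ : LagIdx n d → ℝ}
    (hθ : ∀ e, θ e ≠ 0) : Function.Injective (lagState σ θ) :=
  lag_injective hσ.injective hσ.map_zero θ (fun _ => hθ _) (fun _ => hθ _)

lemma schemeA₁_mulVec_lag (z : HiddenIdx n d M m → ℝ) (S : StateIdx (n + 1) d M m → ℝ)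
    (p : Fin (n + 1) × Fin d) :
    (schemeA₁ z *ᵥ S) (.inr (.inr p)) = (schemeA₁₂ z *ᵥ fun q => S (.inr (.inr q))) p := by
  simp [Matrix.mulVec, dotProduct, Fintype.sum_sum_type, schemeA₁]

lemma schemeA₁_mulVec_inl (z : HiddenIdx n d M m → ℝ) (S : StateIdx (n + 1) d M m → ℝ)
    (r : Fin M) :
    (schemeA₁ z *ᵥ S) (.inl r) = ∑ c, z (.A₁₁ r c) * S (.inr (.inr c)) := by
  simp [Matrix.mulVec, dotProduct, Fintype.sum_sum_type, schemeA₁]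

lemma schemeA₁_mulVec_inr_inl (z : HiddenIdx n d M m → ℝ) (S : StateIdx (n + 1) d M m → ℝ)
    (s : Σ i : Fin d, Fin (m i)) : (schemeA₁ z *ᵥ S) (.inr (.inl s)) = 0 := by
  simp [Matrix.mulVec, dotProduct, schemeA₁]

lemma schemeA₂_mulVec_inl (z : HiddenIdx n d M m → ℝ) (i : Fin d)
    (S : StateIdx (n + 1) d M m → ℝ) (r : Fin M) : (schemeA₂ z i *ᵥ S) (.inl r) = 0 := by
  simp [Matrix.mulVec, dotProduct, schemeA₂]

lemma schemeA₂_mulVec_lag (z : HiddenIdx n d M m → ℝ) (i : Fin d)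
    (S : StateIdx (n + 1) d M m → ℝ) (p : Fin (n + 1) × Fin d) :
    (schemeA₂ z i *ᵥ S) (.inr (.inr p)) = 0 := by
  simp [Matrix.mulVec, dotProduct, schemeA₂]

lemma schemeA₂_mulVec_inr_inl (z : HiddenIdx n d M m → ℝ) (i : Fin d)
    (S : StateIdx (n + 1) d M m → ℝ) (s : Σ i : Fin d, Fin (m i)) :
    (schemeA₂ z i *ᵥ S) (.inr (.inl s)) =
      if s.1 = i then ∑ c, z (.A₂ s.1 s.2 c) * S (.inr (.inr c)) else 0 := by
  simp only [Matrix.mulVec, dotProduct, Fintype.sum_sum_type, schemeA₂]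
  split_ifs with h <;> simp [h]

/-- The rows of the last block read no other block. Among the `A₂` terms, coordinate `(0, i)`
receives only the `i`-th, and the deeper levels receive `σ 0 = 0`. -/
lemma randSig_lag (h0 : σ 0 = 0) (z : HiddenIdx n d M m → ℝ) (x : Fin (n + 1) → Fin d → ℝ)
    (t : Fin (n + 1)) (p : Fin (n + 1) × Fin d) :
    randSig σ (schemeA₁ z) (schemeξ₁ z) (schemeA₂ z) (schemeξ₂ z) x t.castSucc (.inr (.inr p)) =
      lag σ (schemeA₁₂ z) (fun i => z (.α i)) (Fin.init x) t p := by
  induction t using Fin.induction generalizing p with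
  | zero => rfl
  | succ t ih =>
    rw [← Fin.succ_castSucc, randSig_succ, lag_succ, ih p]
    simp only [Pi.add_apply, schemeA₁_mulVec_lag, schemeA₂_mulVec_lag, zero_add, ih]
    congr 1
    · simp [schemeξ₁]
    · obtain ⟨k, i⟩ := p
      by_cases hk : k = 0
      · subst hk
        rw [Finset.sum_eq_single i]
        · simp [schemeξ₂, Fin.init]
        · intro j _ hj
          simp [schemeξ₂, hj.symm, h0]
        · simp
      · simp [schemeξ₂, hk, h0]

/-- The output of the scheme is affine in the last datum, and its coefficients are networks with one
hidden layer whose input is the last block of the state. -/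
theorem outputVec_dotProduct_schemeDeltaRS (h0 : σ 0 = 0) (z : HiddenIdx n d M m → ℝ)
    (x : Fin (n + 1) → Fin d → ℝ) (w₀ : Fin M → ℝ) (w : (i : Fin d) → Fin (m i) → ℝ) :
    outputVec (n + 1) w₀ w ⬝ᵥ schemeDeltaRS σ z x =
      ∑ r, w₀ r * neuron σ (fun o => z (o.elim (.ξ₁ r) (.A₁₁ r)))
        (lagState σ (fun e => z e.incl) (Fin.init x)) +
      ∑ i, (∑ r, w i r * neuron σ (fun o => z (o.elim (.ξ₂ i r) (.A₂ i r)))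
        (lagState σ (fun e => z e.incl) (Fin.init x))) * x (Fin.last n) i := by
  have hlag : ∀ p, randSig σ (schemeA₁ z) (schemeξ₁ z) (schemeA₂ z) (schemeξ₂ z) x
      (Fin.last n).castSucc (.inr (.inr p)) = lagState σ (fun e => z e.incl) (Fin.init x) p :=
    fun p => randSig_lag h0 z x (Fin.last n) p
  simp only [dotProduct, Fintype.sum_sum_type, outputVec, zero_mul, Finset.sum_const_zero, add_zero]
  congr 1
  · refine Finset.sum_congr rfl fun r _ => ?_
    congr 1
    rw [schemeDeltaRS, deltaRS, Pi.sub_apply, ← Fin.succ_last, randSig_succ]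
    simp only [Pi.add_apply, schemeA₁_mulVec_inl, schemeA₂_mulVec_inl, hlag, schemeξ₁, schemeξ₂,
      h0, zero_mul, Finset.sum_const_zero, add_zero, add_sub_cancel_left]
    rfl
  · rw [Fintype.sum_sigma]
    refine Finset.sum_congr rfl fun i _ => ?_
    rw [Finset.sum_mul]
    refine Finset.sum_congr rfl fun r _ => ?_
    rw [mul_assoc]
    congr 1
    rw [schemeDeltaRS, deltaRS, Pi.sub_apply, ← Fin.succ_last, randSig_succ]
    simp only [Pi.add_apply, schemeA₁_mulVec_inr_inl, schemeA₂_mulVec_inr_inl, hlag, schemeξ₁,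
      schemeξ₂, h0, add_zero, add_sub_cancel_left]
    -- In block `i` the terms with `j ≠ i` have zero weights and bias, hence contribute `σ 0 = 0`.
    rw [Finset.sum_eq_single i]
    · simp [neuron]
    · intro j _ hj
      simp [hj.symm, h0]
    · simp

end Dynamics

/-! ### Random features for the sampling scheme -/

section Sampling

variable {n d M : ℕ} {m : Fin d → ℕ} {Ω : Type*} [MeasurableSpace Ω] {P : Measure Ω}
  {μ : Measure ℝ} {ζ : HiddenIdx n d M m → Ω → ℝ}

/-- This law does not involve `M` and `m`, so the widths can be chosen from it, separately for each
network. -/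
lemma IsSamplingScheme₂.map_lag [Fintype (LagIdx n d)] (hζ : IsSamplingScheme₂ P μ ζ) :
    P.map (fun ω (e : LagIdx n d) => ζ e.incl ω) = Measure.pi fun _ => μ := by
  have h := (hζ.indep.precomp (LagIdx.incl_injective (n := n) (d := d))).map_fun_eq_pi_map
    fun e => (hζ.measurable _).aemeasurable
  simpa only [Function.comp_apply, hζ.law] using h

/-- The names of the weights and the bias of a neuron of the block `0`. -/
def neuronIdx₁ (e : Fin M × Option (Fin (n + 1) × Fin d)) : HiddenIdx n d M m :=
  e.2.elim (.ξ₁ e.1) (.A₁₁ e.1)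

/-- The names of the weights and the bias of a neuron of the block `i`. -/
def neuronIdx₂ (i : Fin d) (e : Fin (m i) × Option (Fin (n + 1) × Fin d)) : HiddenIdx n d M m :=
  e.2.elim (.ξ₂ i e.1) (.A₂ i e.1)

lemma neuronIdx₁_injective : Function.Injective (neuronIdx₁ : _ → HiddenIdx n d M m) := by
  rintro ⟨r, _ | c⟩ ⟨s, _ | c'⟩ h <;> simp_all [neuronIdx₁]

lemma neuronIdx₂_injective (i : Fin d) :
    Function.Injective (neuronIdx₂ i : _ → HiddenIdx n d M m) := by
  rintro ⟨r, _ | c⟩ ⟨s, _ | c'⟩ h <;> simp_all [neuronIdx₂]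

/-- For a large width, neurons with i.i.d. weights, composed with the random last block of the state,
approximate a given continuous function of the datastream with high probability. -/
theorem exists_width_lagState [Fintype (LagIdx n d)] {Q : Set (Fin n → Fin d → ℝ)}
    (hQ : IsCompact Q) {σ : ℝ → ℝ} (hσ : IsAdmissibleActivation σ)
    (μ : Measure ℝ) [IsProbabilityMeasure μ] [μ.IsOpenPosMeasure] (hμ : μ ≪ volume)
    {G : (Fin n → Fin d → ℝ) → ℝ} (hG : ContinuousOn G Q) {ε δ : ℝ} (hε : 0 < ε) (hδ : 0 < δ) :
    ∃ L : ℕ, 0 < L ∧ ∀ (Ω : Type*) [MeasurableSpace Ω] (P : Measure Ω) [IsProbabilityMeasure P]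
      (θ : Ω → LagIdx n d → ℝ) (ζ : Fin L × Option (Fin (n + 1) × Fin d) → Ω → ℝ),
      Measurable θ → P.map θ = Measure.pi (fun _ => μ) →
      (∀ e, Measurable (ζ e)) → iIndepFun ζ P → (∀ e, P.map (ζ e) = μ) →
      ∃ E : Set Ω, MeasurableSet E ∧ P.real Eᶜ ≤ δ ∧ ∀ ω ∈ E, ∃ w : Fin L → ℝ, ∀ y ∈ Q,
        |G y - ∑ r, w r * neuron σ (fun o => ζ (r, o) ω) (lagState σ (θ ω) y)| < ε := by
  let X : Type := Q
  have hX : CompactSpace X := isCompact_iff_compactSpace.1 hQ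
  have hatoms : NullSingletonClass μ := ⟨fun x => hμ (by simp)⟩
  let ν : Measure (LagIdx n d → ℝ) := Measure.pi fun _ => μ
  let Y : (LagIdx n d → ℝ) → X → Fin (n + 1) × Fin d → ℝ := fun θ y => lagState σ θ y.1
  have hY : Continuous fun p : (LagIdx n d → ℝ) × X => Y p.1 p.2 :=
    (continuous_lagState (n := n) (d := d) hσ.continuous).comp
      (g := fun p : (LagIdx n d → ℝ) × (Fin n → Fin d → ℝ) => lagState σ p.1 p.2)
      (f := fun p : (LagIdx n d → ℝ) × X => (p.1, p.2.1))
      (continuous_fst.prodMk (continuous_subtype_val.comp continuous_snd))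
  -- On this set the embedding is injective; it has full measure because `μ` has no atoms.
  let Θ₀ : Set (LagIdx n d → ℝ) := ⋂ e, {θ | θ e = 0}ᶜ
  have hΘ₀ : MeasurableSet Θ₀ := .iInter fun e =>
    (measurableSet_eq_fun (measurable_pi_apply e) measurable_const).compl
  have hν : ν Θ₀ = 1 := by
    rw [← prob_compl_eq_zero_iff hΘ₀, Set.compl_iInter]
    refine measure_iUnion_null fun e => ?_
    rw [compl_compl]
    exact Measure.pi_hyperplane (fun _ => μ) e 0
  have hinj : ∀ θ ∈ Θ₀, Function.Injective (Y θ) := fun θ hθ =>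
    (lagState_injective hσ (by simpa [Θ₀] using hθ)).comp Subtype.val_injective
  obtain ⟨L, hL, happ⟩ := exists_width_random_features hσ μ ν hY hΘ₀ hν hinj
    ⟨fun y : X => G y.1, hG.domRestrict⟩ hε (ENNReal.ofReal_pos.2 hδ)
  refine ⟨L, hL, fun Ω _ P _ θ ζ hθ hθν hζ hind hlaw => ?_⟩
  obtain ⟨E, hEm, hE, hw⟩ := happ Ω P θ ζ hθ hθν hζ hind hlaw
  refine ⟨E, hEm, ENNReal.toReal_le_of_le_ofReal hδ.le hE, fun ω hω => ?_⟩
  obtain ⟨w, hw⟩ := hw ω hω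
  exact ⟨w, fun y hy => hw ⟨y, hy⟩⟩

end Sampling

end RandSig

/-! ### The main theorem -/

open RandSig

theorem mainTheorem2 {d n : ℕ} (K : Set (Fin d → ℝ)) (hK : IsCompact K)
    (σ : ℝ → ℝ) (hσ : RandSig.IsAdmissibleActivation σ)
    (μ : Measure ℝ) [IsProbabilityMeasure μ] [μ.IsOpenPosMeasure] (hμ : μ ≪ volume)
    (g : (Fin n → Fin d → ℝ) → ℝ) (hg : ContinuousOn g (Set.univ.pi fun _ => K))
    (h : Fin d → (Fin n → Fin d → ℝ) → ℝ)
    (hh : ∀ i, ContinuousOn (h i) (Set.univ.pi fun _ => K))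
    (f : (Fin (n + 1) → Fin d → ℝ) → ℝ)
    (hf : ∀ x ∈ Set.univ.pi fun _ => K,
      f x = g (Fin.init x) + ∑ i, h i (Fin.init x) * x (Fin.last n) i)
    (α : ℝ) (hα : α ∈ Set.Ioo (0 : ℝ) 1) (ε : ℝ) (hε : 0 < ε) :
    ∃ (M : ℕ) (m : Fin d → ℕ), 0 < M ∧ (∀ i, 0 < m i) ∧
      ∀ (Ω : Type*) [MeasurableSpace Ω] (P : Measure Ω) [IsProbabilityMeasure P]
        (ζ : RandSig.HiddenIdx n d M m → Ω → ℝ), RandSig.IsSamplingScheme₂ P μ ζ →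
        ∃ E : Set Ω, MeasurableSet E ∧ α < P.real E ∧
          ∀ ω ∈ E, ∃ (w₀ : Fin M → ℝ) (w : (i : Fin d) → Fin (m i) → ℝ),
            (⨆ x ∈ Set.univ.pi fun _ : Fin (n + 1) => K,
              ‖f x - RandSig.outputVec (n + 1) w₀ w ⬝ᵥ
                RandSig.schemeDeltaRS σ (fun e => ζ e ω) x‖ₑ) < ENNReal.ofReal ε := by
  classical
  have : Fintype (LagIdx n d) := Fintype.ofFinite _
  have hQ : IsCompact (Set.univ.pi fun _ : Fin n => K) := isCompact_univ_pi fun _ => hK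
  obtain ⟨R, hR0, hR⟩ : ∃ R : ℝ, 0 ≤ R ∧ ∀ y ∈ K, ‖y‖ ≤ R := by
    obtain ⟨R, hR⟩ := hK.isBounded.exists_norm_le
    exact ⟨max R 0, le_max_right _ _, fun y hy => (hR y hy).trans (le_max_left _ _)⟩
  have hD : 0 < 1 + d * R := by positivity
  -- Errors `η` for `g` and for each `h i`, the latter multiplied by `|x_T^i| ≤ R`, add up to `ε /
  -- 2`; the spare half keeps the supremum strictly below `ε`.
  have hη : 0 < ε / (2 * (1 + d * R)) := by positivity
  set η := ε / (2 * (1 + d * R)) with hη_def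
  -- The `d + 1` networks fail with total probability at most `(1 - α) / 2 < 1 - α`.
  have hδ0 : 0 < (1 - α) / (2 * (d + 1)) := div_pos (sub_pos.2 hα.2) (by positivity)
  set δ := (1 - α) / (2 * (d + 1)) with hδ_def
  obtain ⟨M, hM, hg_app⟩ := exists_width_lagState hQ hσ μ hμ hg hη hδ0
  choose m hm hh_app using fun i => exists_width_lagState hQ hσ μ hμ (hh i) hη hδ0
  refine ⟨M, m, hM, hm, fun Ω _ P _ ζ hζ => ?_⟩
  have hθm : Measurable fun ω (e : LagIdx n d) => ζ e.incl ω :=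
    measurable_pi_lambda _ fun e => hζ.measurable _
  obtain ⟨E₀, hE₀m, hE₀, happ₀⟩ := hg_app Ω P _ (fun e => ζ (neuronIdx₁ e)) hθm hζ.map_lag
    (fun e => hζ.measurable _) (hζ.indep.precomp neuronIdx₁_injective) (fun e => hζ.law _)
  choose E hEm hE happ using fun i => hh_app i Ω P _ (fun e => ζ (neuronIdx₂ i e)) hθm hζ.map_lag
    (fun e => hζ.measurable _) (hζ.indep.precomp (neuronIdx₂_injective i)) (fun e => hζ.law _)
  refine ⟨E₀ ∩ ⋂ i, E i, hE₀m.inter (.iInter hEm), ?_, ?_⟩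
  · have hcompl : P.real (E₀ ∩ ⋂ i, E i)ᶜ ≤ (d + 1) * δ := by
      rw [Set.compl_inter, Set.compl_iInter]
      calc P.real (E₀ᶜ ∪ ⋃ i, (E i)ᶜ) ≤ P.real E₀ᶜ + ∑ i, P.real (E i)ᶜ :=
            (measureReal_union_le _ _).trans
              (add_le_add_right (measureReal_iUnion_fintype_le _) _)
        _ ≤ δ + ∑ _i : Fin d, δ :=
            add_le_add hE₀ (Finset.sum_le_sum fun i _ => hE i)
        _ = (d + 1) * δ := by simp; ring
    have hδe : (d + 1) * δ = (1 - α) / 2 := by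
      rw [hδ_def]; field_simp
    have hsum := probReal_compl_eq_one_sub (μ := P) (hE₀m.inter (.iInter hEm))
    linarith [hα.2]
  · rintro ω ⟨hω₀, hω⟩
    obtain ⟨w₀, hw₀⟩ := happ₀ ω hω₀
    choose w hw using fun i => happ i ω (Set.mem_iInter.1 hω i)
    refine ⟨w₀, w, ?_⟩
    have hbound : ∀ x ∈ Set.univ.pi fun _ : Fin (n + 1) => K,
        ‖f x - outputVec (n + 1) w₀ w ⬝ᵥ schemeDeltaRS σ (fun e => ζ e ω) x‖ ≤ ε / 2 := by
      intro x hx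
      have hinit : Fin.init x ∈ Set.univ.pi fun _ : Fin n => K := fun t _ => hx t.castSucc trivial
      rw [hf x hx, outputVec_dotProduct_schemeDeltaRS hσ.map_zero, add_sub_add_comm,
        ← Finset.sum_sub_distrib]
      simp_rw [← sub_mul]
      have h₀ := (hw₀ _ hinit).le
      have hi := fun i => (hw i _ hinit).le
      have hxi : ∀ i, ‖x (Fin.last n) i‖ ≤ R := fun i =>
        (norm_le_pi_norm _ i).trans (hR _ (hx (Fin.last n) trivial))
      calc _ ≤ η + ∑ _i : Fin d, η * R := by
            refine (norm_add_le _ _).trans (add_le_add h₀ ((norm_sum_le _ _).trans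
              (Finset.sum_le_sum fun i _ => ?_)))
            rw [norm_mul]
            exact mul_le_mul (hi i) (hxi i) (norm_nonneg _) hη.le
        _ = η * (1 + d * R) := by simp; ring
        _ = ε / 2 := by rw [hη_def]; field_simp
    calc (⨆ x ∈ Set.univ.pi fun _ : Fin (n + 1) => K,
          ‖f x - outputVec (n + 1) w₀ w ⬝ᵥ schemeDeltaRS σ (fun e => ζ e ω) x‖ₑ)
        ≤ ENNReal.ofReal (ε / 2) := iSup₂_le fun x hx => by
          rw [← ofReal_norm]
          exact ENNReal.ofReal_le_ofReal (hbound x hx)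
      _ < ENNReal.ofReal ε := (ENNReal.ofReal_lt_ofReal_iff hε).2 (half_lt_self hε)
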